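/- Let $k\ge 0$ and $d_1,\dots,d_k\ge 1$ be integers, let $D=\prod_{i=1}^k d_i$, and let $r\ge 0$ be an integer such that $D>r+\sum_{i=1}^k(d_i-1)$. A product state in $\bigotimes_{i=1}^k\mathbb{C}^{d_i}$ is a vector $\varphi_1\otimes\cdots\otimes\varphi_k$ in which every $\varphi_i\in\mathbb{C}^{d_i}$ is a unit vector. For a linear operator $A$ on $\bigotimes_{i=1}^k\mathbb{C}^{d_i}\cong\mathbb{C}^D$ put $$\nu(A)=\max\{\operatorname{Re}\operatorname{tr}(|x\rangle\langle x|\,A) : x \text{ a product state}\}$$ (the trace is real when $A$ is Hermitian). Let $V$ be a uniformly random $r$-dimensional subspace of $\bigotimes_{i=1}^k\mathbb{C}^{d_i}$; that is, $V$ is a random subspace, defined on some probability space, such that the orthogonal projector $\Pi$ onto $V$ has the law of $U\Pi_0U^*$, where $\Pi_0$ is a fixed orthogonal projector of rank $r$ and $U$ is distributed according to the normalized Haar measure on the unitary group of $\bigotimes_{i=1}^k\mathbb{C}^{d_i}$. Then the probability that $V$ contains a product state is zero. Equivalently, $\nu(\Pi)<1$ with probability one; indeed, a subspace $W$ contains no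 product state if and only if $\nu(\Pi_W)<1$, where $\Pi_W$ is the orthogonal projector onto $W$. -/

import Mathlib

open MeasureTheory ProbabilityTheory
open scoped InnerProductSpace

noncomputable section

namespace RandomSubspace

section Uniform

variable {H : Type*} [NormedAddCommGroup H] [InnerProductSpace ℂ H] [FiniteDimensional ℂ H]

/-- The unitary group of a finite-dimensional complex Hilbert space is compact. -/
instance compactSpace_unitary : CompactSpace (unitary (H →L[ℂ] H)) := by
  have : ProperSpace (H →L[ℂ] H) := FiniteDimensional.proper ℂ _
  refine isCompact_iff_compactSpace.mp ?_
  refine Metric.isCompact_of_isClosed_isBounded ?_ ?_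
  · have h : ((unitary (H →L[ℂ] H) : Submonoid (H →L[ℂ] H)) : Set (H →L[ℂ] H)) =
        {u | star u * u = 1} ∩ {u | u * star u = 1} := by
      ext u; exact Unitary.mem_iff
    rw [h]
    exact (isClosed_eq (by fun_prop) continuous_const).inter
      (isClosed_eq (by fun_prop) continuous_const)
  · refine (Metric.isBounded_closedBall (x := (0 : H →L[ℂ] H)) (r := 1)).subset ?_
    intro u hu
    rw [mem_closedBall_zero_iff]
    refine ContinuousLinearMap.opNorm_le_bound _ zero_le_one fun x => ?_
    rw [one_mul]
    exact ((Unitary.linearIsometryEquiv ⟨u, hu⟩).norm_map x).le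

/-- The normalized Haar measure on the unitary group of `H`. -/
def unitaryHaar (H : Type*) [NormedAddCommGroup H] [InnerProductSpace ℂ H]
    [FiniteDimensional ℂ H] : Measure (unitary (H →L[ℂ] H)) :=
  Measure.haarMeasure ⊤

instance : IsProbabilityMeasure (unitaryHaar H) :=
  ⟨Measure.haarMeasure_self (K₀ := (⊤ : TopologicalSpace.PositiveCompacts _))⟩

/-- The law of `U P U*`, where `U` is a Haar random unitary and `P` is the orthogonal
projector onto the fixed subspace `W`, that is, of the orthogonal projector onto `U W`. -/
def rotatedProjectorLaw (W : Submodule ℂ H) : Measure (H →L[ℂ] H) :=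
  (unitaryHaar H).map fun U : unitary (H →L[ℂ] H) =>
    (U : H →L[ℂ] H) * W.starProjection * star (U : H →L[ℂ] H)

instance (W : Submodule ℂ H) : IsProbabilityMeasure (rotatedProjectorLaw W) :=
  Measure.isProbabilityMeasure_map (Continuous.measurable (by fun_prop)).aemeasurable

/-- `V` is a uniformly random subspace of `H` of dimension `r`: the orthogonal projector onto
`V` has the law of `U P U*` with `U` Haar random and `P` a fixed rank-`r` orthogonal projector.
By invariance of the Haar measure this law does not depend on `P`. -/
def IsUniformlyRandom {Ω : Type*} [MeasurableSpace Ω] (V : Ω → Submodule ℂ H) (r : ℕ)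
    (μ : Measure Ω) : Prop :=
  ∃ W : Submodule ℂ H, Module.finrank ℂ W = r ∧
    HasLaw (fun ω => (V ω).starProjection) (rotatedProjectorLaw W) μ

end Uniform

section Product

variable {k : ℕ} {d : Fin k → ℕ}

/-- The Hilbert space `ℂ^{d₁} ⊗ ⋯ ⊗ ℂ^{d_k}`, written in the product basis
`|j₁⟩ ⊗ ⋯ ⊗ |j_k⟩`. -/
abbrev TensorSpace (d : Fin k → ℕ) : Type := EuclideanSpace ℂ (∀ i, Fin (d i))

/-- The product vector `φ₁ ⊗ ⋯ ⊗ φ_k`. -/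
def productVector (φ : ∀ i, EuclideanSpace ℂ (Fin (d i))) : TensorSpace d :=
  WithLp.toLp 2 fun j => ∏ i, φ i (j i)

/-- The product states: the vectors `φ₁ ⊗ ⋯ ⊗ φ_k` with all `φ_i` unit vectors. -/
def productStates (d : Fin k → ℕ) : Set (TensorSpace d) :=
  {x | ∃ φ : ∀ i, EuclideanSpace ℂ (Fin (d i)), (∀ i, ‖φ i‖ = 1) ∧ x = productVector φ}

/-- The real number `tr (|x⟩⟨x| A)`. -/
def overlap (A : TensorSpace d →L[ℂ] TensorSpace d) (x : TensorSpace d) : ℝ :=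
  (LinearMap.trace ℂ (TensorSpace d)
    (InnerProductSpace.rankOne ℂ x x ∘L A : TensorSpace d →L[ℂ] TensorSpace d)).re

/-- `ν(A)`, the maximum of `tr (φ₁ ⊗ ⋯ ⊗ φ_k) A` over all product states. -/
def nu (A : TensorSpace d →L[ℂ] TensorSpace d) : ℝ :=
  sSup (overlap A '' productStates d)

theorem overlap_eq (A : TensorSpace d →L[ℂ] TensorSpace d) (x : TensorSpace d) :
    overlap A x = (⟪x, A x⟫_ℂ).re := by
  rw [overlap, ContinuousLinearMap.toLinearMap_comp, LinearMap.trace_comp_comm',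
    ← ContinuousLinearMap.toLinearMap_comp, InnerProductSpace.comp_rankOne,
    InnerProductSpace.trace_rankOne]

theorem isCompact_productStates : IsCompact (productStates d) := by
  have h : productStates d = productVector ''
      Set.univ.pi fun i => Metric.sphere (0 : EuclideanSpace ℂ (Fin (d i))) 1 := by
    ext x
    simp only [productStates, Set.mem_ofPred_eq, Set.mem_image, Set.mem_univ_pi,
      mem_sphere_zero_iff_norm, eq_comm (a := x)]
  rw [h]
  refine (isCompact_univ_pi fun i => isCompact_sphere _ _).image ?_
  unfold productVector
  fun_prop

/-- The supremum defining `ν(A)` is a maximum. -/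
theorem isGreatest_nu (hd : ∀ i, 0 < d i) (A : TensorSpace d →L[ℂ] TensorSpace d) :
    IsGreatest (overlap A '' productStates d) (nu A) := by
  have hne : (productStates d).Nonempty :=
    ⟨_, fun i => EuclideanSpace.single ⟨0, hd i⟩ 1, fun i => by simp, rfl⟩
  refine (isCompact_productStates.image ?_).isGreatest_sSup (hne.image _)
  simp_rw [funext (overlap_eq A)]
  fun_prop

end Product

end RandomSubspace

end

namespace RandomSubspace

open Module

/-! ### Dimension counting for null sets. -/

section NullSets

/-! The cone of product vectors is covered by finitely many smooth charts of dimension `1 + ∑ (d i -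
1)`, so by `measure_linearCombination_mem_cone` Lebesgue-almost every `r`-tuple has no nontrivial
combination in it; the same holds for its image under any unitary. Fubini on pairs (unitary, tuple)
yields one tuple `v` whose span, rotated by almost every `U`, misses the cone. Right invariance of
Haar measure carries this from the span of `v` to any fixed `r`-dimensional `W`
(`unitaryHaar_rotation_meets_eq_zero`). -/

theorem measure_range_eq_zero_of_finrank_lt {E F : Type*} [NormedAddCommGroup E] [NormedSpace ℂ E]
    [FiniteDimensional ℂ E] [NormedAddCommGroup F] [NormedSpace ℂ F] [FiniteDimensional ℂ F]
    [MeasurableSpace F] [BorelSpace F] (ν : Measure F) [ν.IsAddHaarMeasure]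
    {f : E → F} (hf : ContDiff ℂ 1 f) (h : finrank ℂ E < finrank ℂ F) :
    ν (Set.range f) = 0 := by
  have : FiniteDimensional ℝ F := FiniteDimensional.complexToReal F
  have : FiniteDimensional ℝ E := FiniteDimensional.complexToReal E
  have hdim : dimH (Set.range f) < (finrank ℝ F : NNReal) := by
    refine (hf.restrict_scalars ℝ).dimH_range_le.trans_lt ?_
    rw [finrank_real_of_complex, finrank_real_of_complex]
    exact_mod_cast (by lia : 2 * finrank ℂ E < 2 * finrank ℂ F)
  refine measure_zero_of_dimH_lt (d := (finrank ℝ F : NNReal)) ?_ hdim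
  rw [NNReal.coe_natCast]
  exact Measure.absolutelyContinuous_isAddHaarMeasure _ _

/-- If a complex cone is covered by countably many smooth images of spaces of dimension at most
`dim H - r`, then almost no `r`-tuple of vectors has a nontrivial linear combination in it. -/
theorem measure_linearCombination_mem_cone {H ι : Type*} {P : ι → Type*} [NormedAddCommGroup H]
    [NormedSpace ℂ H] [FiniteDimensional ℂ H] [MeasurableSpace H] [BorelSpace H]
    [∀ m, NormedAddCommGroup (P m)] [∀ m, NormedSpace ℂ (P m)]
    [∀ m, FiniteDimensional ℂ (P m)] [Countable ι] {r : ℕ}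
    (ν : Measure (Fin r → H)) [ν.IsAddHaarMeasure] {C : Set H}
    (hC : ∀ (a : ℂ), ∀ x ∈ C, a • x ∈ C) {F : ∀ m, P m → H} (hF : ∀ m, ContDiff ℂ 1 (F m))
    (hCF : C ⊆ ⋃ m, Set.range (F m)) (hr : ∀ m, r + finrank ℂ (P m) ≤ finrank ℂ H) :
    ν {v | ∃ c : Fin r → ℂ, c ≠ 0 ∧ ∑ i, c i • v i ∈ C} = 0 := by
  have : ProperSpace H := FiniteDimensional.proper ℂ H
  -- Solving for a `v j` with `c j ≠ 0` leaves `(r - 1) * (dim H + 1) + dim (P m)` parameters, fewer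
  -- than `r * dim H` by `hr`.
  let Φ (j : Fin r) (m : ι) (p : ({i : Fin r // i ≠ j} → H) × ({i : Fin r // i ≠ j} → ℂ) × P m) :
      Fin r → H := fun i =>
    if h : i ≠ j then p.1 ⟨i, h⟩ else F m p.2.2 + ∑ i, p.2.1 i • p.1 i
  have hΦ (j m) : ContDiff ℂ 1 (Φ j m) := by
    refine contDiff_pi.2 fun i => ?_
    have hFm := hF m
    by_cases h : i ≠ j
    · simp only [Φ, dif_pos h]
      fun_prop
    · simp only [Φ, dif_neg h]
      fun_prop
  have hnull (j m) : ν (Set.range (Φ j m)) = 0 := by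
    refine measure_range_eq_zero_of_finrank_lt ν (hΦ j m) ?_
    have hcard : Fintype.card {i : Fin r // i ≠ j} = r - 1 := by simp
    have hr0 : 0 < r := j.pos
    have hrm := hr m
    simp only [finrank_prod, finrank_pi, finrank_pi_fintype, Finset.sum_const, Finset.card_univ,
      hcard, Fintype.card_fin, smul_eq_mul]
    obtain ⟨s, rfl⟩ : ∃ s, r = s + 1 := ⟨r - 1, by lia⟩
    simp only [Nat.add_sub_cancel, add_mul, one_mul]
    lia
  refine measure_mono_null (t := ⋃ j, ⋃ m, Set.range (Φ j m)) ?_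
    (measure_iUnion_null fun j => measure_iUnion_null fun m => hnull j m)
  rintro v ⟨c, hc, hv⟩
  obtain ⟨j, hj⟩ := Function.ne_iff.1 hc
  obtain ⟨m, p, hp⟩ := Set.mem_iUnion.1 (hCF (hC (c j)⁻¹ _ hv))
  refine Set.mem_iUnion.2 ⟨j, Set.mem_iUnion.2 ⟨m,
    ⟨fun i => v i, fun i => -((c j)⁻¹ * c i), p⟩, ?_⟩⟩
  funext i
  by_cases h : i ≠ j
  · simp [Φ, h]
  · obtain rfl : i = j := not_not.1 h
    simp only [Φ, ne_eq, not_true_eq_false, dite_false, hp]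
    rw [Fintype.sum_eq_add_sum_subtype_ne _ i]
    simp [smul_add, smul_smul, inv_mul_cancel₀ hj, Finset.smul_sum]

end NullSets

/-! ### Unitary group and Haar measure. -/

section Uniform

variable {H : Type*} [NormedAddCommGroup H] [InnerProductSpace ℂ H] [FiniteDimensional ℂ H]

theorem exists_unitary_map_eq {W W' : Submodule ℂ H} (h : finrank ℂ W = finrank ℂ W') :
    ∃ U : unitary (H →L[ℂ] H), ∀ x, (U : H →L[ℂ] H) x ∈ W' ↔ x ∈ W := by
  let e : W ≃ₗᵢ[ℂ] W' :=
    (stdOrthonormalBasis ℂ W).equiv (stdOrthonormalBasis ℂ W') (finCongr h)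
  let L : H →ₗᵢ[ℂ] H := (W'.subtypeₗᵢ.comp e.toLinearIsometry).extend
  have hL (x : W) : L x = e x := LinearIsometry.extend_apply _ x
  refine ⟨Unitary.linearIsometryEquiv.symm (L.toLinearIsometryEquiv rfl), fun x => ?_⟩
  change L x ∈ W' ↔ x ∈ W
  constructor
  · intro hx
    have h1 := hL (e.symm ⟨L x, hx⟩)
    rw [e.apply_symm_apply] at h1
    rw [← L.injective h1]
    exact Subtype.coe_prop _
  · intro hx
    rw [hL ⟨x, hx⟩]
    exact Subtype.coe_prop _

instance secondCountableTopology_unitary : SecondCountableTopology (unitary (H →L[ℂ] H)) := by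
  have : ProperSpace (H →L[ℂ] H) := FiniteDimensional.proper ℂ _
  infer_instance

instance isHaarMeasure_unitaryHaar : (unitaryHaar H).IsHaarMeasure :=
  inferInstanceAs (Measure.haarMeasure ⊤).IsHaarMeasure

instance isMulRightInvariant_unitaryHaar : (unitaryHaar H).IsMulRightInvariant := by
  refine ⟨fun g => ?_⟩
  have : IsProbabilityMeasure ((unitaryHaar H).map (· * g)) :=
    Measure.isProbabilityMeasure_map (measurable_mul_const g).aemeasurable
  -- The right translate is again left invariant with total mass one, so uniqueness identifies it
  -- with the original.
  have h := Measure.haarMeasure_unique ((unitaryHaar H).map (· * g)) ⊤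
  rwa [TopologicalSpace.PositiveCompacts.coe_top, measure_univ, one_smul] at h

end Uniform

/-- Projection along a compact factor is a closed map. With `A` a projector, this makes the event of
meeting `K` measurable in terms of its law. -/
theorem isClosed_exists_fixed {H : Type*} [NormedAddCommGroup H] [NormedSpace ℂ H]
    {K : Set H} (hK : IsCompact K) :
    IsClosed {A : H →L[ℂ] H | ∃ x ∈ K, A x = x} := by
  have : CompactSpace K := isCompact_iff_compactSpace.1 hK
  have hcl : IsClosed {q : K × (H →L[ℂ] H) | q.2 q.1 = (q.1 : H)} :=
    isClosed_eq (by fun_prop) (by fun_prop)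
  convert isClosedMap_snd_of_compactSpace _ hcl using 1
  ext A
  simp

/-! ### Random rotations avoiding a compact set. -/

section Uniform

variable {H : Type*} [NormedAddCommGroup H] [InnerProductSpace ℂ H] [FiniteDimensional ℂ H]

theorem unitary_apply_star_apply (U : unitary (H →L[ℂ] H)) (x : H) :
    (U : H →L[ℂ] H) (star (U : H →L[ℂ] H) x) = x :=
  congr($(Unitary.coe_mul_star_self U) x)

theorem star_apply_unitary_apply (U : unitary (H →L[ℂ] H)) (x : H) :
    star (U : H →L[ℂ] H) ((U : H →L[ℂ] H) x) = x :=
  congr($(Unitary.coe_star_mul_self U) x)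

/-- The pairs `(U, v)` such that some nontrivial linear combination of the vectors `U v_i` is a
multiple of a vector in `K`, provided that `K` consists of unit vectors. -/
def dependentPairs (K : Set H) (r : ℕ) : Set (unitary (H →L[ℂ] H) × (Fin r → H)) :=
  {q | ∃ c : EuclideanSpace ℂ (Fin r), ‖c‖ = 1 ∧ ∃ x ∈ K,
    (q.1 : H →L[ℂ] H) (∑ i, c i • q.2 i) = ⟪x, (q.1 : H →L[ℂ] H) (∑ i, c i • q.2 i)⟫_ℂ • x}

/-- Normalizing `c` and writing the scalar as an inner product leaves only compact quantifiers.
Closedness supplies the measurability Fubini needs. -/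
theorem isClosed_dependentPairs {K : Set H} (hK : IsCompact K) (r : ℕ) :
    IsClosed (dependentPairs K r) := by
  have : CompactSpace K := isCompact_iff_compactSpace.1 hK
  let S := Metric.sphere (0 : EuclideanSpace ℂ (Fin r)) 1
  have : CompactSpace S := isCompact_iff_compactSpace.1 (isCompact_sphere _ _)
  have hcl : IsClosed {q : (S × K) × (unitary (H →L[ℂ] H) × (Fin r → H)) |
      (q.2.1 : H →L[ℂ] H) (∑ i, q.1.1.1 i • q.2.2 i) =
        ⟪(q.1.2 : H), (q.2.1 : H →L[ℂ] H) (∑ i, q.1.1.1 i • q.2.2 i)⟫_ℂ • (q.1.2 : H)} := by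
    refine isClosed_eq ?_ ?_
    · fun_prop
    · fun_prop
  convert isClosedMap_snd_of_compactSpace _ hcl using 1
  ext q
  simp [dependentPairs, S]

theorem mem_dependentPairs {K : Set H} (hK1 : ∀ x ∈ K, ‖x‖ = 1) {r : ℕ}
    {U : unitary (H →L[ℂ] H)} {v : Fin r → H} {c : Fin r → ℂ} (hc : c ≠ 0) {x : H} (hx : x ∈ K)
    {a : ℂ} (h : (U : H →L[ℂ] H) (∑ i, c i • v i) = a • x) : (U, v) ∈ dependentPairs K r := by
  let c' : EuclideanSpace ℂ (Fin r) := WithLp.toLp 2 c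
  have hc' : c' ≠ 0 := fun h0 => hc (by simpa [c'] using h0)
  have hsum : (U : H →L[ℂ] H) (∑ i, ((‖c'‖⁻¹ : ℂ) • c') i • v i) = ((‖c'‖⁻¹ : ℂ) * a) • x := by
    simp only [PiLp.smul_apply, smul_eq_mul, mul_smul, ← Finset.smul_sum, map_smul, ← h]
    rfl
  refine ⟨(‖c'‖⁻¹ : ℂ) • c', ?_, x, hx, ?_⟩
  · simp [norm_smul, hc']
  · rw [hsum, inner_smul_right, inner_self_eq_norm_sq_to_K, hK1 x hx]
    simp

/-- A Haar random rotation of a fixed `r`-dimensional subspace almost surely avoids a compact set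
of unit vectors whose cone is covered by smooth images of spaces of dimension at most
`dim H - r`. -/
theorem unitaryHaar_rotation_meets_eq_zero {ι : Type*} {P : ι → Type*}
    [∀ m, NormedAddCommGroup (P m)] [∀ m, NormedSpace ℂ (P m)]
    [∀ m, FiniteDimensional ℂ (P m)] [Countable ι] {K : Set H} (hK : IsCompact K) (hK1 : ∀ x ∈ K, ‖x‖ = 1)
    {F : ∀ m, P m → H} (hF : ∀ m, ContDiff ℂ 1 (F m))
    (hKF : ∀ x ∈ K, ∀ a : ℂ, ∃ m p, F m p = a • x) (W : Submodule ℂ H)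
    (hr : ∀ m, finrank ℂ W + finrank ℂ (P m) ≤ finrank ℂ H) :
    unitaryHaar H {U | ∃ x ∈ K, star (U : H →L[ℂ] H) x ∈ W} = 0 := by
  borelize H
  have : ProperSpace H := FiniteDimensional.proper ℂ H
  have : ProperSpace (H →L[ℂ] H) := FiniteDimensional.proper ℂ _
  obtain rfl | ⟨x₀, hx₀⟩ := K.eq_empty_or_nonempty
  · simp
  set r := finrank ℂ W
  let E := dependentPairs K r
  let ν : Measure (Fin r → H) := Measure.addHaar
  have hEm : MeasurableSet E := (isClosed_dependentPairs hK r).measurableSet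
  have hfiber (U : unitary (H →L[ℂ] H)) : ν {v | (U, v) ∈ E} = 0 := by
    refine measure_mono_null ?_ (measure_linearCombination_mem_cone ν
      (C := {y | ∃ a : ℂ, ∃ x ∈ K, y = a • star (U : H →L[ℂ] H) x})
      (F := fun m p => star (U : H →L[ℂ] H) (F m p)) ?_ ?_ ?_ hr)
    · rintro v ⟨c, hc, x, hx, h⟩
      refine ⟨c, fun h0 => ?_, ⟪x, (U : H →L[ℂ] H) (∑ i, c i • v i)⟫_ℂ, x, hx, ?_⟩
      · have : c = 0 := by ext i; exact congrFun h0 i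
        simp [this] at hc
      · rw [← map_smul]
        exact (star_apply_unitary_apply U _).symm.trans (congrArg _ h)
    · rintro a _ ⟨b, x, hx, rfl⟩
      exact ⟨a * b, x, hx, (mul_smul _ _ _).symm⟩
    · intro m
      have hFm := hF m
      fun_prop
    · rintro _ ⟨a, x, hx, rfl⟩
      obtain ⟨m, p, h⟩ := hKF x hx a
      exact Set.mem_iUnion.2 ⟨m, p, by simp [h]⟩
  have hae : ∀ᵐ v ∂ν, ∀ᵐ U ∂unitaryHaar H, (U, v) ∉ E := by
    rw [← Measure.ae_ae_comm (p := fun U v => (U, v) ∉ E) hEm.compl]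
    refine ae_of_all _ fun U => ?_
    rw [ae_iff]
    simpa using hfiber U
  obtain ⟨v, hv⟩ := hae.exists
  -- A vanishing combination is the multiple `0 • x₀`, so a dependent tuple would lie in every fiber
  -- of `E`.
  have hli : LinearIndependent ℂ v := by
    obtain ⟨U, hU⟩ := hv.exists
    rw [Fintype.linearIndependent_iff]
    intro c hc
    by_contra! hne
    obtain ⟨i, hi⟩ := hne
    exact hU (mem_dependentPairs hK1 (Function.ne_iff.2 ⟨i, hi⟩) hx₀ (a := 0) (by simp [hc]))
  obtain ⟨U₀, hU₀⟩ := exists_unitary_map_eq (W := Submodule.span ℂ (Set.range v)) (W' := W)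
    (by rw [finrank_span_eq_card hli, Fintype.card_fin])
  have hnull : unitaryHaar H {U | (U, v) ∈ E} = 0 := by
    simpa [ae_iff] using hv
  rw [← measure_preimage_mul_right (unitaryHaar H) U₀] at hnull
  have hsub : {U : unitary (H →L[ℂ] H) | ∃ x ∈ K, star (U : H →L[ℂ] H) x ∈ W} ⊆
      (fun U => U * U₀) ⁻¹' {U | (U, v) ∈ E} := by
    rintro U ⟨x, hx, hxW⟩
    have hmem : star (U₀ : H →L[ℂ] H) (star (U : H →L[ℂ] H) x) ∈
        Submodule.span ℂ (Set.range v) := by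
      rw [← hU₀, unitary_apply_star_apply]
      exact hxW
    obtain ⟨c, hc⟩ := (Submodule.mem_span_range_iff_exists_fun ℂ).1 hmem
    have hUx : ((U * U₀ : unitary (H →L[ℂ] H)) : H →L[ℂ] H) (∑ i, c i • v i) = (1 : ℂ) • x := by
      rw [hc, Submonoid.coe_mul, mul_apply_eq_comp, unitary_apply_star_apply,
        unitary_apply_star_apply, one_smul]
    refine mem_dependentPairs hK1 ?_ hx hUx
    rintro rfl
    simp only [Pi.zero_apply, zero_smul, Finset.sum_const_zero, map_zero, one_smul] at hUx
    simpa [← hUx] using hK1 x hx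
  exact measure_mono_null hsub hnull

theorem IsUniformlyRandom.measure_meets_eq_zero {Ω : Type*} [MeasurableSpace Ω] {μ : Measure Ω}
    {V : Ω → Submodule ℂ H} {r : ℕ} (hV : IsUniformlyRandom V r μ) {ι : Type*} {P : ι → Type*}
    [∀ m, NormedAddCommGroup (P m)] [∀ m, NormedSpace ℂ (P m)]
    [∀ m, FiniteDimensional ℂ (P m)] [Countable ι] {K : Set H}
    (hK : IsCompact K) (hK1 : ∀ x ∈ K, ‖x‖ = 1) {F : ∀ m, P m → H} (hF : ∀ m, ContDiff ℂ 1 (F m))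
    (hKF : ∀ x ∈ K, ∀ a : ℂ, ∃ m p, F m p = a • x)
    (hr : ∀ m, r + finrank ℂ (P m) ≤ finrank ℂ H) :
    μ {ω | ∃ x ∈ K, x ∈ V ω} = 0 := by
  obtain ⟨W, rfl, hlaw⟩ := hV
  have hS : MeasurableSet {A : H →L[ℂ] H | ∃ x ∈ K, A x = x} :=
    (isClosed_exists_fixed hK).measurableSet
  have h := hlaw.measure_eq hS
  rw [rotatedProjectorLaw, Measure.map_apply (Continuous.measurable (by fun_prop)) hS] at h
  simp only [Submodule.starProjection_eq_self_iff] at h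
  rw [h]
  refine measure_mono_null ?_ (unitaryHaar_rotation_meets_eq_zero hK hK1 hF hKF W hr)
  rintro U ⟨x, hx, hUx⟩
  refine ⟨x, hx, ?_⟩
  rw [mul_apply_eq_comp, mul_apply_eq_comp] at hUx
  have := congrArg (⇑(star (U : H →L[ℂ] H))) hUx
  rwa [star_apply_unitary_apply, Submodule.starProjection_eq_self_iff] at this

end Uniform

/-! ### Product vectors and their overlaps. -/

section Product

variable {k : ℕ} {d : Fin k → ℕ}

theorem norm_productVector (φ : ∀ i, EuclideanSpace ℂ (Fin (d i))) :
    ‖productVector φ‖ = ∏ i, ‖φ i‖ := by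
  rw [← sq_eq_sq₀ (norm_nonneg _) (Finset.prod_nonneg fun i _ => norm_nonneg _),
    ← Finset.prod_pow]
  simp only [EuclideanSpace.norm_sq_eq, productVector, norm_prod, ← Finset.prod_pow]
  exact (Fintype.prod_sum fun i b => ‖φ i b‖ ^ 2).symm

theorem norm_eq_one_of_mem_productStates {x : TensorSpace d} (hx : x ∈ productStates d) :
    ‖x‖ = 1 := by
  obtain ⟨φ, hφ, rfl⟩ := hx
  simp [norm_productVector, hφ]

/-- The affine chart of the cone of product vectors in which the coordinate `a i` of the `i`-th
factor is one. -/
def productChart (a : ∀ i, Fin (d i)) (p : ℂ × (∀ i, {b // b ≠ a i} → ℂ)) : TensorSpace d :=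
  p.1 • productVector fun i => WithLp.toLp 2 fun b => if h : b ≠ a i then p.2 i ⟨b, h⟩ else 1

theorem contDiff_productChart (a : ∀ i, Fin (d i)) : ContDiff ℂ 1 (productChart a) := by
  refine contDiff_euclidean.2 fun j => ?_
  simp only [productChart, productVector, PiLp.smul_apply]
  refine contDiff_fst.smul (contDiff_prod fun i _ => ?_)
  by_cases h : j i ≠ a i
  · simp only [dif_pos h]
    have hi : ContDiff ℂ 1 fun p : ℂ × (∀ i, {b // b ≠ a i} → ℂ) => p.2 i :=
      contDiff_pi.1 contDiff_snd i
    exact contDiff_pi.1 hi ⟨j i, h⟩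
  · simp only [dif_neg h]
    fun_prop

/-- Each unit factor has a nonzero coordinate; dividing by it lands in a chart, and the scalar
absorbs the divisors. -/
theorem exists_productChart_eq {x : TensorSpace d} (hx : x ∈ productStates d) (t : ℂ) :
    ∃ a p, productChart a p = t • x := by
  obtain ⟨φ, hφ, rfl⟩ := hx
  have hne (i) : ∃ b, φ i b ≠ 0 := by
    by_contra! h
    have h0 : φ i = 0 := by ext b; exact h b
    simpa [h0] using hφ i
  choose a ha using hne
  refine ⟨a, (t * ∏ i, φ i (a i), fun i b => φ i b / φ i (a i)), ?_⟩
  ext j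
  simp only [productChart, productVector, PiLp.smul_apply, smul_eq_mul, mul_assoc,
    ← Finset.prod_mul_distrib]
  congr 1
  refine Finset.prod_congr rfl fun i _ => ?_
  by_cases h : j i ≠ a i
  · simp only [dif_pos h]
    field_simp [ha i]
  · simp [not_not.1 h]

theorem overlap_starProjection (W : Submodule ℂ (TensorSpace d)) (x : TensorSpace d) :
    overlap W.starProjection x = ‖W.starProjection x‖ ^ 2 := by
  have hP := W.starProjection_eq_self_iff.2 (W.starProjection_apply_mem x)
  have h : ⟪x, W.starProjection x⟫_ℂ = ⟪W.starProjection x, W.starProjection x⟫_ℂ := by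
    rw [Submodule.inner_starProjection_left_eq_right, hP]
  rw [overlap_eq, h]
  exact inner_self_eq_norm_sq (𝕜 := ℂ) _

/-- The overlap is the squared norm of the projection of a unit vector, equal to one exactly on `W`;
since the maximum is attained, avoidance gives strict inequality. -/
theorem nu_starProjection_lt_one_iff (hd : ∀ i, 0 < d i) (W : Submodule ℂ (TensorSpace d)) :
    (¬ ∃ x ∈ productStates d, x ∈ W) ↔ nu W.starProjection < 1 := by
  have hnu := isGreatest_nu hd W.starProjection
  constructor
  · intro h
    obtain ⟨x, hx, hxnu⟩ := hnu.1
    rw [← hxnu, overlap_starProjection, sq_lt_one_iff₀ (norm_nonneg _)]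
    have hx1 := norm_eq_one_of_mem_productStates hx
    refine lt_of_le_of_ne (hx1 ▸ W.norm_starProjection_apply_le x) fun h1 => h ⟨x, hx, ?_⟩
    rw [W.mem_iff_norm_starProjection, h1, hx1]
  · rintro h ⟨x, hx, hxW⟩
    refine h.not_ge (hnu.2 ⟨x, hx, ?_⟩)
    rw [overlap_starProjection, W.norm_starProjection_apply hxW,
      norm_eq_one_of_mem_productStates hx, one_pow]

end Product

end RandomSubspace

open RandomSubspace in
theorem mainTheorem7 {Ω : Type*} [MeasurableSpace Ω] (μ : Measure Ω) [IsProbabilityMeasure μ]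
    (k : ℕ) (d : Fin k → ℕ) (hd : ∀ i, 0 < d i) (r : ℕ)
    (hD : r + ∑ i, (d i - 1) < ∏ i, d i)
    (V : Ω → Submodule ℂ (TensorSpace d)) (hV : IsUniformlyRandom V r μ) :
    μ {ω | ∃ x ∈ productStates d, x ∈ V ω} = 0 ∧
    (∀ᵐ ω ∂μ, nu (V ω).starProjection < 1) ∧
    (∀ W : Submodule ℂ (TensorSpace d),
      (¬ ∃ x ∈ productStates d, x ∈ W) ↔ nu W.starProjection < 1) := by
  have hnull : μ {ω | ∃ x ∈ productStates d, x ∈ V ω} = 0 := by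
    refine hV.measure_meets_eq_zero isCompact_productStates
      (fun _ => norm_eq_one_of_mem_productStates) (fun a => contDiff_productChart a)
      (fun _ => exists_productChart_eq) fun a => ?_
    -- The strictness of `hD` pays for the extra scalar parameter of the chart.
    simp [Module.finrank_prod, Module.finrank_pi_fintype]
    lia
  refine ⟨hnull, ?_, nu_starProjection_lt_one_iff hd⟩
  simp_rw [← nu_starProjection_lt_one_iff hd, ae_iff, not_not]
  exact hnull
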